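/- **Setting.** A parity game $G=(V,V_0,V_1,E,c)$ consists of a finite (possibly empty) set $V$ of nodes partitioned into $V_0$ and $V_1$, an edge relation $E\subseteq V\times V$ such that every node has at least one successor, and a coloring $c\colon V\to\mathbb N$. Write $v.E$ for the set of successors of $v$. A play from $v_0$ is an infinite path $v_0v_1v_2\dots$ in $(V,E)$; it is won by player $p\in\{0,1\}$ iff the least color occurring infinitely often along it is congruent to $p$ modulo $2$. A strategy for player $p$ is a function $\tau\colon V_p\to V$ with $(v,\tau(v))\in E$ for all $v\in V_p$; a play is consistent with $\tau$ if $v_{i+1}=\tau(v_i)$ whenever $v_i\in V_p$. The winning region $W_p(G)$ of player $p$ is the set of nodes $v$ for which player $p$ has a strategy $\tau$ such that all plays from $v$ consistent with $\tau$ are won by $p$. For a set $X$ of nodes, let $\mathrm{Attr}_p[G,X]$ be the least fixed point of $$Z\mapsto X\cup\{v\in V_p\mid v.E\cap Z\neq\emptyset\}\cup\{v\in V_{1-p}\mid v.E\subseteq Z\}.$$ For a set $X$ of nodes of color $d$ and $p=d\bmod 2$, let the monotone attractor $\mathrm{MA}(X)$ be the least fixed point of $$Z\mapsto\{v\in V_p\mid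 c(v)\ge d,\ v.E\cap(Z\cup X)\ne\emptyset\}\cup\{v\in V_{1-p}\mid c(v)\ge d,\ v.E\subseteq Z\cup X\}.$$ It is fatal if $X\subseteq\mathrm{MA}(X)$. For a node $k$ write $\mathrm{MA}(k)=\mathrm{MA}(\{k\})$. **Solver psol.** On input $G$, go through the nodes $k$ of $G$ in descending order of color (ties broken arbitrarily). If $k\in\mathrm{MA}(k)$, computed in the current game $G$, then classify the nodes of $A=\mathrm{Attr}_{p}[G,\mathrm{MA}(k)]$, where $p=c(k)\bmod 2$, as won by player $p$, and return the result of calling psol on the sub-game $G\setminus A$. Otherwise remove from $G$ all edges $(k,w)$ with $w\in\mathrm{MA}(k)$ and continue with the next node. If all nodes have been processed, return the current $G$. **Solver psolB.** On input $G$, go through the colors $d$ of $G$ in descending order. For each $d$ start with $X=\{v\in V\mid c(v)=d\}$; as long as $X\neq\emptyset$ and $X\not\subseteq\mathrm{MA}(X)$, replace $X$ by $X\cap\mathrm{MA}(X)$. If a nonempty $X$ with $X\subseteq\mathrm{MA}(X)$ is reached, classify the nodes of $A=\mathrm{Attr}_{p}[G,\mathrm{MA}(X)]$, where $p=d\bmod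 2$, as won by player $p$, and return the result of calling psolB on the sub-game $G\setminus A$. If $X$ becomes empty, continue with the next color. If all colors have been processed, return $G$. For $\rho\in\{\text{psol},\text{psolB}\}$ let $\mathrm{Win}_p(\rho,G)$ be the set of all nodes classified as won by player $p$ during the run of $\rho$ on $G$, including its recursive calls. **Theorem.** The partial solvers psol and psolB are sound: for every parity game $G$ and every player $p\in\{0,1\}$, $$\mathrm{Win}_p(\text{psol},G)\subseteq W_p(G)\qquad\text{and}\qquad \mathrm{Win}_p(\text{psolB},G)\subseteq W_p(G),$$ for psol regardless of how ties in the node ordering are broken. -/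

import Mathlib

/-- A finite parity game whose nodes form a finite, possibly empty, set inside an ambient type `α`.
Players are `0, 1 : Fin 2`. The values of `owner` and `color` outside `nodes` are irrelevant. -/
structure ParityGame (α : Type*) where
  nodes : Finset α
  owner : α → Fin 2
  E : α → α → Prop
  color : α → ℕ
  edge_mem : ∀ v w, E v w → v ∈ nodes ∧ w ∈ nodes
  total : ∀ v ∈ nodes, ∃ w, E v w

namespace ParityGame

variable {α : Type*}

/-- The player `c % 2`. -/
def parity (c : ℕ) : Fin 2 := ⟨c % 2, Nat.mod_lt c two_pos⟩

/-- `V_p`, the nodes owned by player `p`. -/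
def V (G : ParityGame α) (p : Fin 2) : Set α := {v | v ∈ G.nodes ∧ G.owner v = p}

/-- `v.E`, the set of successors of `v`. -/
def succs (G : ParityGame α) (v : α) : Set α := {w | G.E v w}

/-! ### Plays, strategies, winning regions -/

/-- `r` is an infinite play from `v`. -/
def IsPlayFrom (G : ParityGame α) (v : α) (r : ℕ → α) : Prop :=
  v ∈ G.nodes ∧ r 0 = v ∧ ∀ i, G.E (r i) (r (i + 1))

/-- The colors that occur infinitely often along `r`. -/
def infColors (G : ParityGame α) (r : ℕ → α) : Set ℕ :=
  {k | ∀ j : ℕ, ∃ i, i > j ∧ k = G.color (r i)}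

/-- Player `p` wins `r` iff the least color occurring infinitely often has parity `p`.
(Along a play `infColors` is nonempty, as there are finitely many nodes, so `sInf` is a minimum.) -/
def WonBy (G : ParityGame α) (p : Fin 2) (r : ℕ → α) : Prop :=
  parity (sInf (G.infColors r)) = p

/-- `τ` is a (memoryless) strategy of player `p`; only its values on `V_p` matter. -/
def IsStrategy (G : ParityGame α) (p : Fin 2) (τ : α → α) : Prop :=
  ∀ v ∈ G.V p, G.E v (τ v)

/-- The play `r` is consistent with the strategy `τ` of player `p`. -/
def Consistent (G : ParityGame α) (p : Fin 2) (τ : α → α) (r : ℕ → α) : Prop :=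
  ∀ i, r i ∈ G.V p → r (i + 1) = τ (r i)

/-- The winning region of player `p`: the nodes from which some strategy of `p` wins every
consistent play. -/
def winningRegion (G : ParityGame α) (p : Fin 2) : Set α :=
  {v | v ∈ G.nodes ∧ ∃ τ : α → α, G.IsStrategy p τ ∧
    ∀ r, G.IsPlayFrom v r → G.Consistent p τ r → G.WonBy p r}

/-! ### Attractors and monotone attractors -/

/-- Control predecessor of `X` for player `p`. -/
def cpre (G : ParityGame α) (p : Fin 2) (X : Set α) : Set α :=
  {v | v ∈ G.V p ∧ (G.succs v ∩ X).Nonempty} ∪ {v | v ∈ G.V (1 - p) ∧ G.succs v ⊆ X}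

/-- Monotone control predecessor of `A` for player `p` with target `X` and color bound `c`. -/
def mpre (G : ParityGame α) (p : Fin 2) (A X : Set α) (c : ℕ) : Set α :=
  {v | v ∈ G.V p ∧ c ≤ G.color v ∧ (G.succs v ∩ (A ∪ X)).Nonempty} ∪
    {v | v ∈ G.V (1 - p) ∧ c ≤ G.color v ∧ G.succs v ⊆ A ∪ X}

theorem cpre_mono (G : ParityGame α) (p : Fin 2) : Monotone (G.cpre p) := by
  rintro A B h v (⟨h1, w, h2, h3⟩ | ⟨h1, h2⟩)
  · exact Or.inl ⟨h1, w, h2, h h3⟩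
  · exact Or.inr ⟨h1, h2.trans h⟩

theorem mpre_mono (G : ParityGame α) (p : Fin 2) (X : Set α) (c : ℕ) :
    Monotone (fun A => G.mpre p A X c) := by
  rintro A B h v (⟨h1, h2, w, h3, h4⟩ | ⟨h1, h2, h3⟩)
  · exact Or.inl ⟨h1, h2, w, h3, Set.union_subset_union_left X h h4⟩
  · exact Or.inr ⟨h1, h2, h3.trans (Set.union_subset_union_left X h)⟩

/-- The attractor of `X` for player `p`: the least fixed point of `Z ↦ X ∪ cpre p Z`. -/
def attr (G : ParityGame α) (p : Fin 2) (X : Set α) : Set α :=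
  OrderHom.lfp ⟨fun Z => X ∪ G.cpre p Z, fun _ _ h => Set.union_subset_union_right X (G.cpre_mono p h)⟩

/-- The monotone attractor for player `p` with target `X` and color bound `c`:
the least fixed point of `Z ↦ mpre p Z X c`. -/
def mattr (G : ParityGame α) (p : Fin 2) (X : Set α) (c : ℕ) : Set α :=
  OrderHom.lfp ⟨fun Z => G.mpre p Z X c, G.mpre_mono p X c⟩

/-- The monotone attractor `MA(X)` of a set `X` of nodes of color `c`, for player `c % 2`.
It is fatal if it contains `X`. -/
def ma (G : ParityGame α) (X : Set α) (c : ℕ) : Set α := G.mattr (parity c) X c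

theorem attr_eq (G : ParityGame α) (p : Fin 2) (X : Set α) :
    X ∪ G.cpre p (G.attr p X) = G.attr p X :=
  OrderHom.map_lfp ⟨fun Z => X ∪ G.cpre p Z,
    fun _ _ h => Set.union_subset_union_right X (G.cpre_mono p h)⟩

theorem mattr_eq (G : ParityGame α) (p : Fin 2) (X : Set α) (c : ℕ) :
    G.mpre p (G.mattr p X c) X c = G.mattr p X c :=
  OrderHom.map_lfp ⟨fun Z => G.mpre p Z X c, G.mpre_mono p X c⟩

theorem subset_attr (G : ParityGame α) (p : Fin 2) (X : Set α) : X ⊆ G.attr p X := by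
  rw [← attr_eq]; exact Set.subset_union_left

theorem ma_subset_nodes (G : ParityGame α) (X : Set α) (c : ℕ) : G.ma X c ⊆ ↑G.nodes := by
  intro v hv
  rw [ma, ← mattr_eq] at hv
  rcases hv with ⟨h, _⟩ | ⟨h, _⟩ <;> exact h.1

theorem mem_V_or (G : ParityGame α) (p : Fin 2) {v : α} (hv : v ∈ G.nodes) :
    v ∈ G.V p ∨ v ∈ G.V (1 - p) := by
  have key : ∀ o q : Fin 2, o = q ∨ o = 1 - q := by decide
  exact (key (G.owner v) p).imp (fun h => ⟨hv, h⟩) (fun h => ⟨hv, h⟩)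

open Classical in
/-- The sub-game of `G` obtained by removing the attractor of `X` for player `p`. -/
noncomputable def removeAttr (G : ParityGame α) (p : Fin 2) (X : Set α) : ParityGame α where
  nodes := G.nodes.filter (fun v => v ∉ G.attr p X)
  owner := G.owner
  E v w := G.E v w ∧ v ∉ G.attr p X ∧ w ∉ G.attr p X
  color := G.color
  edge_mem v w h := by
    simp only [Finset.mem_filter]
    exact ⟨⟨(G.edge_mem v w h.1).1, h.2.1⟩, ⟨(G.edge_mem v w h.1).2, h.2.2⟩⟩
  total v hv := by
    simp only [Finset.mem_filter] at hv
    obtain ⟨hv, hvA⟩ := hv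
    by_contra! hcon
    have hsub : G.succs v ⊆ G.attr p X := fun w hw => by
      by_contra hw'
      exact hw' (hcon w hw hvA)
    apply hvA
    rw [← attr_eq]
    right
    rcases G.mem_V_or p hv with h | h
    · obtain ⟨w, hw⟩ := G.total v hv
      exact Or.inl ⟨h, w, hw, hsub hw⟩
    · exact Or.inr ⟨h, hsub⟩

/-- The game obtained from `G` by removing all edges `(k, w)` with `w ∈ MA({k})`, where `MA({k})`
is not fatal. -/
def removeEdges (G : ParityGame α) (k : α) (hk : k ∉ G.ma {k} (G.color k)) : ParityGame α where
  nodes := G.nodes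
  owner := G.owner
  E v w := G.E v w ∧ ¬ (v = k ∧ w ∈ G.ma {k} (G.color k))
  color := G.color
  edge_mem v w h := G.edge_mem v w h.1
  total v hv := by
    by_contra! hcon
    obtain ⟨w, hw⟩ := G.total v hv
    obtain ⟨rfl, -⟩ := hcon w hw
    have hsub : G.succs v ⊆ G.ma {v} (G.color v) := fun u hu => (hcon u hu).2
    apply hk
    rw [ma, ← mattr_eq]
    rcases G.mem_V_or (parity (G.color v)) hv with h | h
    · exact Or.inl ⟨h, le_rfl, w, hw, Or.inl (hsub hw)⟩
    · exact Or.inr ⟨h, le_rfl, hsub.trans Set.subset_union_left⟩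

theorem card_removeAttr_lt (G : ParityGame α) (p : Fin 2) (X : Set α) {v : α} (hv : v ∈ G.nodes)
    (hX : v ∈ X) : (G.removeAttr p X).nodes.card < G.nodes.card := by
  classical
  apply Finset.card_lt_card
  refine Finset.filter_ssubset.2 ⟨v, hv, ?_⟩
  exact not_not.2 (G.subset_attr p X hX)

/-! ### The partial solvers -/

/-- The output of a partial solver: the residual game, and for each player `p` the set of nodes
classified as won by `p`. -/
structure SolverResult (α : Type*) where
  residual : ParityGame α
  win : Fin 2 → Set α

open Classical in
/-- Record the nodes of `A` as won by player `p`, in addition to what `R` records. -/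
noncomputable def SolverResult.record (R : SolverResult α) (p : Fin 2) (A : Set α) :
    SolverResult α where
  residual := R.residual
  win q := if q = p then A ∪ R.win q else R.win q

/-- A way of enumerating, for every game, its nodes in descending color ordering
(how ties are broken is left open). -/
structure NodeOrder (α : Type*) where
  list : ParityGame α → List α
  nodup : ∀ G, (list G).Nodup
  mem_iff : ∀ G v, v ∈ list G ↔ v ∈ G.nodes
  descending : ∀ G, (list G).Pairwise (fun v w => G.color w ≤ G.color v)

theorem nonempty_nodeOrder : Nonempty (NodeOrder α) := by
  refine ⟨⟨fun G => G.nodes.toList.mergeSort (fun v w => decide (G.color w ≤ G.color v)),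
    fun G => ?_, fun G v => ?_, fun G => ?_⟩⟩
  · exact (List.mergeSort_perm _ _).nodup_iff.2 G.nodes.nodup_toList
  · simp
  · have := List.pairwise_mergeSort (le := fun v w => decide (G.color w ≤ G.color v))
      (fun a b c h1 h2 => by simp only [decide_eq_true_eq] at *; omega)
      (fun a b => by simp only [Bool.or_eq_true, decide_eq_true_eq]; omega) G.nodes.toList
    simpa using this

/-- The for-loop of `psol` on the current game, with the nodes still to be processed.
If `MA({k})` is fatal, its attractor is recorded as won by player `c(k) % 2` and removed, and `psol`
is called on the rest; otherwise the edges from `k` into `MA({k})`, if any, are removed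
and the iteration continues. -/
noncomputable def psolLoop (o : NodeOrder α) (G : ParityGame α) (ks : List α) : SolverResult α :=
  open Classical in
  match ks with
  | [] => ⟨G, fun _ => ∅⟩
  | k :: ks =>
    if h : k ∈ G.ma {k} (G.color k) then
      (psolLoop o (G.removeAttr (parity (G.color k)) (G.ma {k} (G.color k)))
        (o.list (G.removeAttr (parity (G.color k)) (G.ma {k} (G.color k))))).record
          (parity (G.color k)) (G.attr (parity (G.color k)) (G.ma {k} (G.color k)))
    else psolLoop o (G.removeEdges k h) ks
termination_by (G.nodes.card, ks.length)
decreasing_by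
  · exact Prod.Lex.left _ _ (G.card_removeAttr_lt _ _ (G.ma_subset_nodes _ _ h) h)
  · exact Prod.Lex.right _ (Nat.lt_succ_self _)

/-- The partial solver `psol`. -/
noncomputable def psol (o : NodeOrder α) (G : ParityGame α) : SolverResult α :=
  psolLoop o G (o.list G)

/-- The while-loop of `psolB` for color `d`, with the current values of the variables `X` and
`cache`: it returns the first `X` whose monotone attractor is found to be fatal, if there is one. -/
noncomputable def psolBWhile (G : ParityGame α) (d : ℕ) (X cache : Finset α) :
    Option {Y : Finset α // Y.Nonempty ∧ (Y : Set α) ⊆ G.ma Y d} :=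
  open Classical in
  if h : X.Nonempty ∧ X ≠ cache then
    if hf : (X : Set α) ⊆ G.ma X d then some ⟨X, h.1, hf⟩
    else psolBWhile G d (X.filter (fun v => v ∈ G.ma X d)) X
  else none
termination_by X.card
decreasing_by
  classical
  obtain ⟨v, hv, hv'⟩ := Set.not_subset.1 hf
  exact Finset.card_lt_card (Finset.filter_ssubset.2 ⟨v, hv, hv'⟩)

/-- The colors of `G` in descending order. -/
def colorList (G : ParityGame α) : List ℕ := (G.nodes.image G.color).sort (· ≥ ·)

/-- The for-loop of `psolB`, with the colors still to be processed. If a fatal attractor `MA(X)` is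
found for color `d`, its attractor is recorded as won by player `d % 2` and removed, and `psolB` is
called on the rest. -/
noncomputable def psolBLoop (G : ParityGame α) (ds : List ℕ) : SolverResult α :=
  match ds with
  | [] => ⟨G, fun _ => ∅⟩
  | d :: ds =>
    match psolBWhile G d (G.nodes.filter (fun v => G.color v = d)) ∅ with
    | some ⟨X, _⟩ =>
      (psolBLoop (G.removeAttr (parity d) (G.ma X d))
        (G.removeAttr (parity d) (G.ma X d)).colorList).record
          (parity d) (G.attr (parity d) (G.ma X d))
    | none => psolBLoop G ds
termination_by (G.nodes.card, ds.length)
decreasing_by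
  · rename_i hX
    obtain ⟨⟨v, hv⟩, hX⟩ := hX
    exact Prod.Lex.left _ _ (G.card_removeAttr_lt _ _ (G.ma_subset_nodes _ _ (hX hv)) (hX hv))
  · exact Prod.Lex.right _ (Nat.lt_succ_self _)

/-- The partial solver `psolB`. -/
noncomputable def psolB (G : ParityGame α) : SolverResult α := psolBLoop G G.colorList

end ParityGame

/-! Soundness follows by induction along a run: recorded nodes are won, and neither deleting a won
attractor nor deleting edges enlarges a winning region.

By uniform memoryless determinacy (`exists_strategies_cover`, Zielonka's recursion), a node lies in
the winning region of `p` as soon as no fixed opponent strategy `σ` wins there. Against a fixed `σ`,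
each node of the monotone attractor of `X` has a consistent path to `X` through colors at least `d`.
If `X` is fatal, such paths concatenate to a play in which `d` is the least recurring color, so `σ`
fails there (`attr_ma_subset_winningRegion`).

For the deletions, the opponent's gains lift directly: he either sits in a trap for `p` or has only
lost options. For `p`, the nodes won by `σ` in the old game avoid what is deleted, so `σ` still wins
them and `p` cannot have gained them. In particular, an opponent moving from `k` into the monotone
attractor of `k` can be brought back to `k` forever, so no winning `σ` uses a deleted edge. -/

namespace ParityGame

variable {α : Type*}

/-! ### Consistent steps and the nodes won by a fixed strategy -/

/-- A move from `v` to `w` that is consistent with the strategy `τ` of player `q`. -/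
def Step (G : ParityGame α) (q : Fin 2) (τ : α → α) (v w : α) : Prop :=
  G.E v w ∧ (v ∈ G.V q → w = τ v)

/-- The nodes from which the strategy `τ` of player `q` wins every consistent play. -/
def winSet (G : ParityGame α) (q : Fin 2) (τ : α → α) : Set α :=
  {v | v ∈ G.nodes ∧ ∀ r : ℕ → α, r 0 = v → (∀ i, G.Step q τ (r i) (r (i + 1))) → G.WonBy q r}

theorem mem_winningRegion_iff {G : ParityGame α} {q : Fin 2} {v : α} :
    v ∈ G.winningRegion q ↔ ∃ τ, G.IsStrategy q τ ∧ v ∈ G.winSet q τ := by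
  constructor
  · rintro ⟨hv, τ, hτ, h⟩
    exact ⟨τ, hτ, hv, fun r h0 hr => h r ⟨hv, h0, fun i => (hr i).1⟩ fun i => (hr i).2⟩
  · rintro ⟨τ, hτ, hv, h⟩
    exact ⟨hv, τ, hτ, fun r hr hc => h r hr.2.1 fun i => ⟨hr.2.2 i, hc i⟩⟩

theorem infColors_shift (G : ParityGame α) (r : ℕ → α) (n : ℕ) :
    G.infColors (fun i => r (i + n)) = G.infColors r := by
  ext k
  constructor
  · intro h j
    obtain ⟨i, hi, hk⟩ := h j
    exact ⟨i + n, by omega, hk⟩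
  · intro h j
    obtain ⟨i, hi, hk⟩ := h (j + n)
    exact ⟨i - n, by omega, by simpa [Nat.sub_add_cancel (show n ≤ i by omega)] using hk⟩

theorem wonBy_shift {G : ParityGame α} {q : Fin 2} {r : ℕ → α} (n : ℕ) :
    G.WonBy q (fun i => r (i + n)) ↔ G.WonBy q r := by
  rw [WonBy, WonBy, infColors_shift]

/-- Prepending one move to a play does not change its recurring colors. -/
theorem mem_winSet_of_step {G : ParityGame α} {q : Fin 2} {τ : α → α} {v w : α}
    (hv : v ∈ G.winSet q τ) (h : G.Step q τ v w) : w ∈ G.winSet q τ := by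
  refine ⟨(G.edge_mem _ _ h.1).2, fun r h0 hr => ?_⟩
  let s : ℕ → α
    | 0 => v
    | i + 1 => r i
  have hs := hv.2 s rfl fun i => by
    cases i with
    | zero => simpa [s, h0] using h
    | succ i => exact hr i
  exact (wonBy_shift (r := s) 1).2 hs

theorem wonBy_of_mem_winSet {G : ParityGame α} {q : Fin 2} {τ : α → α} {r : ℕ → α} (n : ℕ)
    (hn : r n ∈ G.winSet q τ) (hr : ∀ i, n ≤ i → G.Step q τ (r i) (r (i + 1))) :
    G.WonBy q r := by
  refine (wonBy_shift n).1 (hn.2 _ (by simp) fun i => ?_)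
  have := hr (i + n) (by omega)
  rwa [show i + n + 1 = i + 1 + n by omega] at this

theorem wonBy_congr {G H : ParityGame α} (hc : H.color = G.color) {q : Fin 2} {r : ℕ → α} :
    H.WonBy q r ↔ G.WonBy q r := by
  simp only [WonBy, infColors, hc]

/-- A set of nodes won by `τ` in `G` is won by `τ'` in `H`, if the consistent moves of `H` from
this set are consistent moves of `G`. -/
theorem winSet_subset_winSet {G H : ParityGame α} (hc : H.color = G.color) {q : Fin 2}
    {τ τ' : α → α} (hn : ∀ v ∈ G.winSet q τ, v ∈ H.nodes)
    (h : ∀ v ∈ G.winSet q τ, ∀ w, H.Step q τ' v w → G.Step q τ v w) :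
    G.winSet q τ ⊆ H.winSet q τ' := by
  intro v hv
  refine ⟨hn v hv, fun r h0 hr => ?_⟩
  have hmem : ∀ i, r i ∈ G.winSet q τ := by
    intro i
    induction i with
    | zero => rwa [h0]
    | succ i ih => exact mem_winSet_of_step ih (h _ ih _ (hr i))
  exact (wonBy_congr hc).2 (hv.2 r h0 fun i => h _ (hmem i) _ (hr i))

theorem sub_sub_fin_two (p : Fin 2) : 1 - (1 - p) = p := by
  revert p; decide

theorem one_sub_ne_fin_two (p : Fin 2) : 1 - p ≠ p := by
  revert p; decide

theorem eq_or_eq_one_sub (p q : Fin 2) : q = p ∨ q = 1 - p := by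
  revert p q; decide

theorem not_mem_V_one_sub {G : ParityGame α} {p : Fin 2} {v : α} (h : v ∈ G.V p) :
    v ∉ G.V (1 - p) := fun h' => one_sub_ne_fin_two p (h'.2.symm.trans h.2)

theorem exists_isStrategy_eqOn (G : ParityGame α) (q : Fin 2) (S : Set α) (f : α → α)
    (hf : ∀ v ∈ G.V q, v ∈ S → G.E v (f v)) :
    ∃ τ, G.IsStrategy q τ ∧ ∀ v ∈ S, τ v = f v := by
  classical
  have (v : α) : ∃ w, (v ∈ S → w = f v) ∧ (v ∈ G.V q → G.E v w) := by
    by_cases hS : v ∈ S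
    · exact ⟨f v, fun _ => rfl, fun h => hf v h hS⟩
    · by_cases hv : v ∈ G.V q
      · obtain ⟨w, hw⟩ := G.total v hv.1
        exact ⟨w, fun h => (hS h).elim, fun _ => hw⟩
      · exact ⟨v, fun h => (hS h).elim, fun h => (hv h).elim⟩
  choose τ h1 h2 using this
  exact ⟨τ, h2, h1⟩

theorem exists_isStrategy (G : ParityGame α) (q : Fin 2) : ∃ τ, G.IsStrategy q τ := by
  obtain ⟨τ, h, -⟩ := G.exists_isStrategy_eqOn q ∅ id (by simp)
  exact ⟨τ, h⟩

/-- No node is won by strategies of both players. -/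
theorem not_mem_winSet_one_sub {G : ParityGame α} {q : Fin 2} {τ σ : α → α}
    (hτ : G.IsStrategy q τ) (hσ : G.IsStrategy (1 - q) σ) {v : α} (hv : v ∈ G.winSet q τ) :
    v ∉ G.winSet (1 - q) σ := by
  classical
  intro hv'
  -- The two strategies together determine a single play, which both players would win.
  have hstep (u : α) : ∃ w, u ∈ G.nodes → G.Step q τ u w ∧ G.Step (1 - q) σ u w := by
    by_cases hu : u ∈ G.nodes
    · rcases G.mem_V_or q hu with h | h
      · exact ⟨τ u, fun _ => ⟨⟨hτ u h, fun _ => rfl⟩,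
          ⟨hτ u h, fun h' => (not_mem_V_one_sub h h').elim⟩⟩⟩
      · exact ⟨σ u, fun _ => ⟨⟨hσ u h, fun h' => (not_mem_V_one_sub h' h).elim⟩,
          ⟨hσ u h, fun _ => rfl⟩⟩⟩
    · exact ⟨u, fun h => (hu h).elim⟩
  choose f hf using hstep
  have hmem : ∀ i, f^[i] v ∈ G.nodes := by
    intro i
    induction i with
    | zero => exact hv.1
    | succ i ih =>
      rw [Function.iterate_succ_apply']
      exact (G.edge_mem _ _ (hf _ ih).1.1).2
  have h1 := hv.2 (fun i => f^[i] v) rfl fun i => by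
    simp only [Function.iterate_succ_apply']
    exact (hf _ (hmem i)).1
  have h2 := hv'.2 (fun i => f^[i] v) rfl fun i => by
    simp only [Function.iterate_succ_apply']
    exact (hf _ (hmem i)).2
  exact one_sub_ne_fin_two q (h2.symm.trans h1)

/-- Recurrence of `d` bounds the infimum from above and also keeps it from being the default value
of `sInf ∅`. -/
theorem wonBy_parity {G : ParityGame α} {r : ℕ → α} {d : ℕ} (n : ℕ)
    (hge : ∀ i, n ≤ i → d ≤ G.color (r i)) (hd : ∀ j, ∃ i, i > j ∧ G.color (r i) = d) :
    G.WonBy (parity d) r := by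
  have hmem : d ∈ G.infColors r := fun j => by
    obtain ⟨i, hi, h⟩ := hd j
    exact ⟨i, hi, h.symm⟩
  have : sInf (G.infColors r) = d := by
    refine le_antisymm (Nat.sInf_le hmem) (le_csInf ⟨d, hmem⟩ fun k hk => ?_)
    obtain ⟨i, hi, rfl⟩ := hk n
    exact hge i hi.le
  rw [WonBy, this]

/-! ### Attractors -/

theorem attr_subset_of_closed {G : ParityGame α} {p : Fin 2} {X Z : Set α}
    (h : X ∪ G.cpre p Z ⊆ Z) : G.attr p X ⊆ Z := OrderHom.lfp_le _ h

theorem mattr_subset_of_closed {G : ParityGame α} {p : Fin 2} {X Z : Set α} {c : ℕ}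
    (h : G.mpre p Z X c ⊆ Z) : G.mattr p X c ⊆ Z := OrderHom.lfp_le _ h

theorem attr_subset_nodes {G : ParityGame α} {p : Fin 2} {X : Set α} (hX : X ⊆ ↑G.nodes) :
    G.attr p X ⊆ ↑G.nodes := by
  refine attr_subset_of_closed (Set.union_subset hX ?_)
  rintro v (h | h) <;> exact h.1.1

/-- The complement of an attractor of `p` is a trap for `p`. -/
theorem not_mem_attr_of_edge {G : ParityGame α} {p : Fin 2} {X : Set α} {v w : α}
    (hv : v ∉ G.attr p X) (hp : v ∈ G.V p) (h : G.E v w) : w ∉ G.attr p X := by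
  intro hw
  apply hv
  rw [← attr_eq]
  exact Or.inr (Or.inl ⟨hp, w, h, hw⟩)

theorem mem_nodes_removeAttr {G : ParityGame α} {p : Fin 2} {X : Set α} {v : α} :
    v ∈ (G.removeAttr p X).nodes ↔ v ∈ G.nodes ∧ v ∉ G.attr p X := by
  simp [removeAttr]

theorem mem_V_removeAttr {G : ParityGame α} {p q : Fin 2} {X : Set α} {v : α} :
    v ∈ (G.removeAttr p X).V q ↔ v ∈ G.V q ∧ v ∉ G.attr p X := by
  simp only [V, Set.mem_ofPred_eq, mem_nodes_removeAttr]
  exact ⟨fun h => ⟨⟨h.1.1, h.2⟩, h.1.2⟩, fun h => ⟨⟨h.1.1, h.2⟩, h.1.2⟩⟩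

/-- The player `p` has a strategy that decreases a rank on the attractor of `X` outside `X`. -/
theorem exists_attr_strategy (G : ParityGame α) (p : Fin 2) (X : Set α) :
    ∃ (σ : α → α) (rank : α → ℕ), G.IsStrategy p σ ∧
      ∀ v ∈ G.attr p X, v ∉ X → ∀ w, G.Step p σ v w → w ∈ G.attr p X ∧ rank w < rank v := by
  classical
  -- The rank is the first stage of the iteration of `F` from `∅` that contains the node; stage 0 is
  -- empty, so ranks on the attractor are positive.
  let F : Set α → Set α := fun Z => X ∪ G.cpre p Z
  have hF : Monotone F := fun _ _ h => Set.union_subset_union_right X (G.cpre_mono p h)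
  let S : ℕ → Set α := fun n => F^[n] ∅
  have hS (n : ℕ) : S (n + 1) = F (S n) := Function.iterate_succ_apply' _ _ _
  have hmono : Monotone S := by
    refine monotone_nat_of_le_succ fun n => ?_
    induction n with
    | zero => exact Set.empty_subset _
    | succ n ih => rw [hS, hS]; exact hF ih
  have hsub : ∀ n, S n ⊆ G.attr p X := by
    intro n
    induction n with
    | zero => exact Set.empty_subset _
    | succ n ih => rw [hS, ← attr_eq]; exact hF ih
  have hcov : G.attr p X ⊆ ⋃ n, S n := by
    refine attr_subset_of_closed (Set.union_subset ?_ ?_)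
    · intro v hv
      exact Set.mem_iUnion.2 ⟨1, by rw [hS]; exact Or.inl hv⟩
    · rintro v (⟨hv, w, hw, hwS⟩ | ⟨hv, hsucc⟩)
      · obtain ⟨n, hn⟩ := Set.mem_iUnion.1 hwS
        exact Set.mem_iUnion.2 ⟨n + 1, by rw [hS]; exact Or.inr (Or.inl ⟨hv, w, hw, hn⟩)⟩
      -- Finitely many successors in an increasing union already lie in one stage, so `ω` stages
      -- suffice.
      · have hfin : (G.succs v).Finite :=
          G.nodes.finite_toSet.subset fun w hw => (G.edge_mem v w hw).2
        obtain ⟨n, hn⟩ := hmono.directed_le.exists_mem_subset_of_finset_subset_biUnion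
          (s := hfin.toFinset) (by simpa using hsucc)
        exact Set.mem_iUnion.2 ⟨n + 1, by
          rw [hS]; exact Or.inr (Or.inr ⟨hv, by simpa using hn⟩)⟩
  let rank : α → ℕ := fun v => if h : ∃ n, v ∈ S n then Nat.find h else 0
  have hrank_mem : ∀ v ∈ G.attr p X, v ∈ S (rank v) := fun v hv => by
    have h : ∃ n, v ∈ S n := Set.mem_iUnion.1 (hcov hv)
    simp only [rank, dif_pos h]
    exact Nat.find_spec h
  have hrank_le : ∀ v n, v ∈ S n → rank v ≤ n := fun v n hv => by
    have h : ∃ n, v ∈ S n := ⟨n, hv⟩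
    simp only [rank, dif_pos h]
    exact Nat.find_min' h hv
  have hpre : ∀ v ∈ G.attr p X, v ∉ X → ∃ n, rank v = n + 1 ∧ v ∈ G.cpre p (S n) := by
    intro v hv hX
    have h := hrank_mem v hv
    cases hn : rank v with
    | zero => rw [hn] at h; exact h.elim
    | succ n =>
      rw [hn, hS] at h
      exact ⟨n, rfl, h.resolve_left hX⟩
  have hchoice (v : α) : ∃ w, v ∈ G.V p → v ∈ G.attr p X \ X →
      G.E v w ∧ w ∈ G.attr p X ∧ rank w < rank v := by
    by_cases hv : v ∈ G.V p ∧ v ∈ G.attr p X \ X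
    · obtain ⟨n, hn, ⟨-, w, hw, hwS⟩ | ⟨h, -⟩⟩ := hpre v hv.2.1 hv.2.2
      · exact ⟨w, fun _ _ => ⟨hw, hsub n hwS, by have := hrank_le w n hwS; omega⟩⟩
      · exact (not_mem_V_one_sub hv.1 h).elim
    · exact ⟨v, fun h1 h2 => (hv ⟨h1, h2⟩).elim⟩
  choose f hf using hchoice
  obtain ⟨σ, hσ, hσf⟩ := G.exists_isStrategy_eqOn p (G.attr p X \ X) f
    fun v h1 h2 => (hf v h1 h2).1
  refine ⟨σ, rank, hσ, fun v hv hX w hw => ?_⟩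
  obtain ⟨n, hn, ⟨h, -⟩ | ⟨-, h⟩⟩ := hpre v hv hX
  · rw [hw.2 h, hσf v ⟨hv, hX⟩]
    exact (hf v h ⟨hv, hX⟩).2
  · have hwS := h hw.1
    exact ⟨hsub n hwS, by have := hrank_le w n hwS; omega⟩

theorem exists_mem_of_rank_decreasing {A X : Set α} {rank : α → ℕ} {r : ℕ → α}
    (h : ∀ i, r i ∈ A → r i ∉ X → r (i + 1) ∈ A ∧ rank (r (i + 1)) < rank (r i))
    (n : ℕ) (hn : r n ∈ A) : ∃ m, n ≤ m ∧ r m ∈ X := by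
  induction hk : rank (r n) using Nat.strong_induction_on generalizing n with
  | _ k ih =>
    by_cases hX : r n ∈ X
    · exact ⟨n, le_rfl, hX⟩
    · obtain ⟨h1, h2⟩ := h n hn hX
      obtain ⟨m, hm, hmX⟩ := ih _ (hk ▸ h2) (n + 1) h1 rfl
      exact ⟨m, by omega, hmX⟩

theorem step_removeAttr {G : ParityGame α} {p q : Fin 2} {X : Set α} {τ σ : α → α} {v w : α}
    (hv : v ∉ G.attr p X) (hw : w ∉ G.attr p X) (h : G.Step q τ v w) (he : τ v = σ v) :
    (G.removeAttr p X).Step q σ v w :=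
  ⟨⟨h.1, hv, hw⟩, fun h' => (h.2 (mem_V_removeAttr.1 h').1).trans he⟩

/-! ### Memoryless determinacy -/

/-- Outside an attractor of player `p`, the opponent wins in the whole game what he wins in the
sub-game. -/
theorem exists_winSet_removeAttr_subset (G : ParityGame α) (p : Fin 2) (X : Set α) {τ' : α → α}
    (hτ' : (G.removeAttr p X).IsStrategy (1 - p) τ') :
    ∃ τ, G.IsStrategy (1 - p) τ ∧ (G.removeAttr p X).winSet (1 - p) τ' ⊆ G.winSet (1 - p) τ := by
  obtain ⟨τ, hτ, heq⟩ := G.exists_isStrategy_eqOn (1 - p) (G.attr p X)ᶜ τ'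
    fun v hv hA => (hτ' v (mem_V_removeAttr.2 ⟨hv, hA⟩)).1
  refine ⟨τ, hτ, winSet_subset_winSet (G := G.removeAttr p X) (H := G) rfl
    (fun v hv => (mem_nodes_removeAttr.1 hv.1).1) ?_⟩
  intro v hv w hw
  obtain ⟨hvn, hvA⟩ := mem_nodes_removeAttr.1 hv.1
  refine step_removeAttr hvA ?_ hw (heq v hvA)
  -- Neither player leaves the sub-game: `p` is trapped, and `τ'` moves inside it.
  rcases G.mem_V_or p hvn with h | h
  · exact not_mem_attr_of_edge hvA h hw.1
  · rw [hw.2 h, heq v hvA]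
    exact (hτ' v (mem_V_removeAttr.2 ⟨h, hvA⟩)).2.2

/-- A winning set can be extended by its attractor and by a winning set of the remaining
sub-game. -/
theorem exists_attr_union_winSet_subset (G : ParityGame α) (q : Fin 2) {τ τ' : α → α}
    (hτ : G.IsStrategy q τ) (hτ' : (G.removeAttr q (G.winSet q τ)).IsStrategy q τ') :
    ∃ ρ, G.IsStrategy q ρ ∧ G.attr q (G.winSet q τ) ∪
      (G.removeAttr q (G.winSet q τ)).winSet q τ' ⊆ G.winSet q ρ := by
  classical
  obtain ⟨σ, rank, hσ, hrank⟩ := G.exists_attr_strategy q (G.winSet q τ)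
  set T := G.winSet q τ with hT
  set A := G.attr q T with hA
  -- Win with `τ` on `T`, approach `T` with `σ` on the rest of the attractor, and play `τ'`
  -- elsewhere.
  let ρ : α → α := fun v => if v ∈ T then τ v else if v ∈ A then σ v else τ' v
  have hρT : ∀ v ∈ T, ρ v = τ v := fun v hv => if_pos hv
  have hρA : ∀ v ∈ A, v ∉ T → ρ v = σ v := fun v hv hvT => by simp only [ρ, if_neg hvT, if_pos hv]
  have hTA : T ⊆ A := G.subset_attr q T
  have hρ' : ∀ v, v ∉ A → ρ v = τ' v := fun v hv => by
    simp only [ρ, if_neg hv, if_neg fun h => hv (hTA h)]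
  have hρ : G.IsStrategy q ρ := by
    intro v hv
    by_cases h1 : v ∈ T
    · rw [hρT v h1]; exact hτ v hv
    by_cases h2 : v ∈ A
    · rw [hρA v h2 h1]; exact hσ v hv
    · rw [hρ' v h2]; exact (hτ' v (mem_V_removeAttr.2 ⟨hv, h2⟩)).1
  refine ⟨ρ, hρ, fun v hv => ⟨?_, fun r h0 hr => ?_⟩⟩
  · rcases hv with hv | hv
    · exact attr_subset_nodes (fun u hu => hu.1) hv
    · exact (mem_nodes_removeAttr.1 hv.1).1
  -- A play that ever enters `A` is driven into `T` and stays there; any other is a play of the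
  -- sub-game.
  by_cases hvis : ∃ n, r n ∈ A
  · obtain ⟨n, hn⟩ := hvis
    obtain ⟨m, -, hm⟩ := exists_mem_of_rank_decreasing (A := A) (X := T) (rank := rank) (r := r)
      (fun i hi hiT => hrank _ hi hiT _ ⟨(hr i).1, fun h => ((hr i).2 h).trans (hρA _ hi hiT)⟩)
      n hn
    have hstep : ∀ i, r i ∈ T → G.Step q τ (r i) (r (i + 1)) := fun i hi =>
      ⟨(hr i).1, fun h => ((hr i).2 h).trans (hρT _ hi)⟩
    have hstay : ∀ i, m ≤ i → r i ∈ T := fun i hi =>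
      Nat.le_induction hm (fun j _ hj => mem_winSet_of_step hj (hstep j hj)) i hi
    exact wonBy_of_mem_winSet m hm fun i hi => hstep i (hstay i hi)
  · push Not at hvis
    have hv' := hv.resolve_left fun h => hvis 0 (h0 ▸ h)
    exact (wonBy_congr (H := G.removeAttr q T) rfl).1 (hv'.2 r h0 fun i =>
      step_removeAttr (hvis i) (hvis (i + 1)) (hr i) (hρ' _ (hvis i)))

/-- If player `d % 2` wins everywhere outside his attractor of the nodes of least color `d`, then
he wins everywhere. -/
theorem exists_nodes_subset_winSet (G : ParityGame α) {d : ℕ} (hd : ∀ v ∈ G.nodes, d ≤ G.color v)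
    {X : Set α} (hX : ∀ v ∈ X, G.color v = d) {τ' : α → α}
    (hτ' : (G.removeAttr (parity d) X).IsStrategy (parity d) τ')
    (hwin : ∀ v ∈ (G.removeAttr (parity d) X).nodes,
      v ∈ (G.removeAttr (parity d) X).winSet (parity d) τ') :
    ∃ ρ, G.IsStrategy (parity d) ρ ∧ ∀ v ∈ G.nodes, v ∈ G.winSet (parity d) ρ := by
  classical
  obtain ⟨σ, rank, hσ, hrank⟩ := G.exists_attr_strategy (parity d) X
  set A := G.attr (parity d) X with hA
  let ρ : α → α := fun v => if v ∈ A then σ v else τ' v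
  have hρA : ∀ v ∈ A, ρ v = σ v := fun v hv => if_pos hv
  have hρ' : ∀ v, v ∉ A → ρ v = τ' v := fun v hv => if_neg hv
  refine ⟨ρ, fun v hv => ?_, fun v hv => ⟨hv, fun r h0 hr => ?_⟩⟩
  · by_cases h : v ∈ A
    · rw [hρA v h]; exact hσ v hv
    · rw [hρ' v h]; exact (hτ' v (mem_V_removeAttr.2 ⟨hv, h⟩)).1
  have hnode : ∀ i, r i ∈ G.nodes := fun i => (G.edge_mem _ _ (hr i).1).1
  -- Recurring visits to `A` force recurring visits to `X`, hence to the least color; otherwise a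
  -- tail of the play stays in the sub-game.
  by_cases hvis : ∀ n, ∃ i, n ≤ i ∧ r i ∈ A
  · refine wonBy_parity 0 (fun i _ => hd _ (hnode i)) fun j => ?_
    obtain ⟨i, hi, hiA⟩ := hvis (j + 1)
    obtain ⟨m, hm, hmX⟩ := exists_mem_of_rank_decreasing (A := A) (X := X) (rank := rank) (r := r)
      (fun i hi hiT => hrank _ hi hiT _ ⟨(hr i).1, fun h => ((hr i).2 h).trans (hρA _ hi)⟩) i hiA
    exact ⟨m, by omega, hX _ hmX⟩
  · push Not at hvis
    obtain ⟨n, hn⟩ := hvis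
    refine (wonBy_congr (H := G.removeAttr (parity d) X) rfl).1 (wonBy_of_mem_winSet n
      (hwin _ (mem_nodes_removeAttr.2 ⟨hnode n, hn n le_rfl⟩)) fun i hi => ?_)
    exact step_removeAttr (hn i hi) (hn (i + 1) (by omega)) (hr i) (hρ' _ (hn i hi))

/-- Uniform memoryless determinacy. -/
theorem exists_strategies_cover (G : ParityGame α) (p : Fin 2) :
    ∃ τ σ : α → α, G.IsStrategy p τ ∧ G.IsStrategy (1 - p) σ ∧
      ∀ v ∈ G.nodes, v ∈ G.winSet p τ ∨ v ∈ G.winSet (1 - p) σ := by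
  induction hn : G.nodes.card using Nat.strong_induction_on generalizing G p with
  | _ n ih =>
  by_cases hne : G.nodes.Nonempty
  swap
  · obtain ⟨τ, hτ⟩ := G.exists_isStrategy p
    obtain ⟨σ, hσ⟩ := G.exists_isStrategy (1 - p)
    exact ⟨τ, σ, hτ, hσ, fun v hv => (hne ⟨v, hv⟩).elim⟩
  obtain ⟨u, hu, hmin⟩ := G.nodes.exists_min_image G.color hne
  set d := G.color u with hd
  -- The claim is symmetric in the players, so `p` may be taken to be the player favored by the
  -- least color.
  suffices H : ∃ τ σ : α → α, G.IsStrategy (parity d) τ ∧ G.IsStrategy (1 - parity d) σ ∧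
      ∀ v ∈ G.nodes, v ∈ G.winSet (parity d) τ ∨ v ∈ G.winSet (1 - parity d) σ by
    obtain ⟨τ, σ, hτ, hσ, h⟩ := H
    rcases eq_or_eq_one_sub (parity d) p with rfl | rfl
    · exact ⟨τ, σ, hτ, hσ, h⟩
    · rw [sub_sub_fin_two]
      exact ⟨σ, τ, hσ, hτ, fun v hv => (h v hv).symm⟩
  clear_value d
  obtain ⟨τ₁, σ₁, hτ₁, hσ₁, h₁⟩ := ih _ (hn ▸ G.card_removeAttr_lt (parity d) {u} hu rfl)
    (G.removeAttr (parity d) {u}) (parity d) rfl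
  -- If the opponent wins something in the sub-game, he wins it in `G`; removing his attractor of
  -- that set leaves a smaller game for a second recursive call. If he wins nothing, `parity d` wins
  -- everywhere.
  by_cases hU : ((G.removeAttr (parity d) {u}).winSet (1 - parity d) σ₁).Nonempty
  · obtain ⟨w, hw⟩ := hU
    obtain ⟨σ₂, hσ₂, hsub⟩ := G.exists_winSet_removeAttr_subset (parity d) {u} hσ₁
    have hwn : w ∈ G.nodes := (mem_nodes_removeAttr.1 hw.1).1
    obtain ⟨σ₃, τ₃, hσ₃, hτ₃, h₃⟩ := ih _
      (hn ▸ G.card_removeAttr_lt (1 - parity d) _ hwn (hsub hw))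
      (G.removeAttr (1 - parity d) (G.winSet (1 - parity d) σ₂)) (1 - parity d) rfl
    obtain ⟨τ, hτ, hτw⟩ := G.exists_winSet_removeAttr_subset (1 - parity d) _ hτ₃
    obtain ⟨σ, hσ, hσw⟩ := G.exists_attr_union_winSet_subset (1 - parity d) hσ₂ hσ₃
    rw [sub_sub_fin_two] at hτ hτw h₃
    refine ⟨τ, σ, hτ, hσ, fun v hv => ?_⟩
    by_cases hA : v ∈ G.attr (1 - parity d) (G.winSet (1 - parity d) σ₂)
    · exact Or.inr (hσw (Or.inl hA))
    · rcases h₃ v (mem_nodes_removeAttr.2 ⟨hv, hA⟩) with h | h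
      · exact Or.inr (hσw (Or.inr h))
      · exact Or.inl (hτw h)
  · obtain ⟨τ, hτ, h⟩ := G.exists_nodes_subset_winSet (X := {u}) hmin
      (by rintro v rfl; exact hd.symm) hτ₁ fun v hv =>
        (h₁ v hv).resolve_right fun h => hU ⟨v, h⟩
    obtain ⟨σ, hσ⟩ := G.exists_isStrategy (1 - parity d)
    exact ⟨τ, σ, hτ, hσ, fun v hv => Or.inl (h v hv)⟩

/-- To show that player `p` wins, it suffices to refute all strategies of the opponent. -/
theorem mem_winningRegion_of_forall_not_mem {G : ParityGame α} {p : Fin 2} {v : α}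
    (hv : v ∈ G.nodes) (h : ∀ σ, G.IsStrategy (1 - p) σ → v ∉ G.winSet (1 - p) σ) :
    v ∈ G.winningRegion p := by
  obtain ⟨τ, σ, hτ, hσ, hc⟩ := G.exists_strategies_cover p
  exact mem_winningRegion_iff.2 ⟨τ, hτ, (hc v hv).resolve_right (h σ hσ)⟩

/-! ### Soundness of the single steps of the solvers -/

/-- If there is a consistent path from every node of `X` back to `X`, along colors that are at least
the color `d` of `X`, then the opponent does not win where such a path starts. -/
theorem not_mem_winSet_of_transGen {G : ParityGame α} {d : ℕ} {X : Set α}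
    (hX : ∀ x ∈ X, G.color x = d) {σ : α → α}
    (hret : ∀ x ∈ X, ∃ y ∈ X, Relation.TransGen
      (fun v w => G.Step (1 - parity d) σ v w ∧ d ≤ G.color v) x y)
    {v : α} (hv : ∃ y ∈ X, Relation.TransGen
      (fun v w => G.Step (1 - parity d) σ v w ∧ d ≤ G.color v) v y) :
    v ∉ G.winSet (1 - parity d) σ := by
  classical
  intro hwin
  set R : α → α → Prop := fun v w => G.Step (1 - parity d) σ v w ∧ d ≤ G.color v with hR
  -- `P n` holds the nodes with an `R`-path of exactly `n` moves into `X`. The rank below is one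
  -- less than the length of a shortest nonempty such path.
  let P : ℕ → Set α := fun n => Nat.rec X (fun _ Z => {v | ∃ w, R v w ∧ w ∈ Z}) n
  have hP : ∀ n v, v ∈ P (n + 1) ↔ ∃ w, R v w ∧ w ∈ P n := fun n v => Iff.rfl
  have hQ : ∀ v, (∃ y ∈ X, Relation.TransGen R v y) → ∃ n, v ∈ P (n + 1) := by
    rintro v ⟨y, hy, h⟩
    induction h using Relation.TransGen.head_induction_on with
    | single h => exact ⟨0, _, h, hy⟩
    | head h _ ih =>
      obtain ⟨n, hn⟩ := ih
      exact ⟨n + 1, _, h, hn⟩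
  let Q : Set α := {v | ∃ n, v ∈ P (n + 1)}
  let rank : α → ℕ := fun v => if h : v ∈ Q then Nat.find h else 0
  have hnext (v : α) : ∃ w, v ∈ Q → R v w ∧ w ∈ Q ∧ (w ∉ X → rank w < rank v) := by
    by_cases hv : v ∈ Q
    · have hs : v ∈ P (Nat.find hv + 1) := Nat.find_spec hv
      have hrk : rank v = Nat.find hv := dif_pos hv
      rw [← hrk] at hs
      obtain ⟨w, hw, hwP⟩ := (hP _ _).1 hs
      refine ⟨w, fun _ => ?_⟩
      cases hn : rank v with
      -- At rank 0 the next node is in `X`, where `hret` supplies a new path; the rank may then rise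
      -- again.
      | zero =>
        rw [hn] at hwP
        exact ⟨hw, hQ w (hret w hwP), fun h => (h hwP).elim⟩
      | succ n =>
        rw [hn] at hwP
        have hwQ : w ∈ Q := ⟨n, hwP⟩
        refine ⟨hw, hwQ, fun _ => ?_⟩
        have : rank w = Nat.find hwQ := dif_pos hwQ
        rw [this]
        exact Nat.lt_succ_of_le (Nat.find_min' hwQ hwP)
    · exact ⟨v, fun h => (hv h).elim⟩
  choose f hf using hnext
  let r : ℕ → α := fun i => f^[i] v
  have hr : ∀ i, r (i + 1) = f (r i) := fun i => Function.iterate_succ_apply' f i v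
  have hrQ : ∀ i, r i ∈ Q := by
    intro i
    induction i with
    | zero => exact hQ v hv
    | succ i ih => rw [hr]; exact (hf _ ih).2.1
  have hvis : ∀ k n, rank (r n) = k → ∃ m, n < m ∧ r m ∈ X := by
    intro k
    induction k using Nat.strong_induction_on with
    | _ k ih =>
      intro n hn
      by_cases hx : r (n + 1) ∈ X
      · exact ⟨n + 1, by omega, hx⟩
      · have hlt : rank (r (n + 1)) < k := by
          rw [hr] at hx ⊢
          rw [← hn]
          exact (hf _ (hrQ n)).2.2 hx
        obtain ⟨m, hm, hmX⟩ := ih _ hlt (n + 1) rfl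
        exact ⟨m, by omega, hmX⟩
  have h1 := hwin.2 r rfl fun i => by rw [hr]; exact (hf _ (hrQ i)).1.1
  have h2 : G.WonBy (parity d) r := wonBy_parity 0 (fun i _ => (hf _ (hrQ i)).1.2) fun j => by
    obtain ⟨m, hm, hmX⟩ := hvis _ j rfl
    exact ⟨m, hm, hX _ hmX⟩
  exact one_sub_ne_fin_two _ (h1.symm.trans h2)

/-- Against every strategy of the opponent there is a path from the monotone attractor of `X`
to `X`. -/
theorem exists_transGen_of_mem_ma {G : ParityGame α} {d : ℕ} {X : Set α} {σ : α → α}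
    (hσ : G.IsStrategy (1 - parity d) σ) {v : α} (hv : v ∈ G.ma X d) :
    ∃ y ∈ X, Relation.TransGen
      (fun v w => G.Step (1 - parity d) σ v w ∧ d ≤ G.color v) v y := by
  -- Least fixed point induction: the nodes having such a path are closed under `mpre`. At nodes of
  -- `parity d` every move is consistent with `σ`; at the opponent's nodes the move of `σ` is taken.
  refine mattr_subset_of_closed (Z := {v | ∃ y ∈ X, Relation.TransGen
      (fun v w => G.Step (1 - parity d) σ v w ∧ d ≤ G.color v) v y}) ?_ hv
  have key : ∀ v w, G.Step (1 - parity d) σ v w → d ≤ G.color v →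
      w ∈ {v | ∃ y ∈ X, Relation.TransGen
        (fun v w => G.Step (1 - parity d) σ v w ∧ d ≤ G.color v) v y} ∪ X →
      ∃ y ∈ X, Relation.TransGen
        (fun v w => G.Step (1 - parity d) σ v w ∧ d ≤ G.color v) v y := by
    rintro v w h hd (⟨y, hy, hwy⟩ | hw)
    · exact ⟨y, hy, .head ⟨h, hd⟩ hwy⟩
    · exact ⟨w, hw, .single ⟨h, hd⟩⟩
  rintro v (⟨hV, hd, w, hw, hwZ⟩ | ⟨hV, hd, hsucc⟩)
  · exact key v w ⟨hw, fun h => (not_mem_V_one_sub hV h).elim⟩ hd hwZ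
  · exact key v (σ v) ⟨hσ v hV, fun _ => rfl⟩ hd (hsucc (hσ v hV))

/-- The attractor of a fatal monotone attractor is won. -/
theorem attr_ma_subset_winningRegion {G : ParityGame α} {d : ℕ} {X : Set α}
    (hX : ∀ x ∈ X, G.color x = d) (hf : X ⊆ G.ma X d) :
    G.attr (parity d) (G.ma X d) ⊆ G.winningRegion (parity d) := by
  intro v hv
  refine mem_winningRegion_of_forall_not_mem
    (attr_subset_nodes (G.ma_subset_nodes X d) hv) fun σ hσ => ?_
  -- What `σ` wins is closed under consistent moves, so its complement is closed under `cpre`.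
  refine attr_subset_of_closed (Z := (G.winSet (1 - parity d) σ)ᶜ) (Set.union_subset ?_ ?_) hv
  · intro u hu
    exact not_mem_winSet_of_transGen hX (fun x hx => exists_transGen_of_mem_ma hσ (hf hx))
      (exists_transGen_of_mem_ma hσ hu)
  · rintro u (⟨hV, w, hw, hwZ⟩ | ⟨hV, hsucc⟩) hu
    · exact hwZ (mem_winSet_of_step hu ⟨hw, fun h => (not_mem_V_one_sub hV h).elim⟩)
    · exact hsucc (hσ u hV) (mem_winSet_of_step hu ⟨hσ u hV, fun _ => rfl⟩)

/-- Removing a won attractor does not enlarge the winning regions. -/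
theorem winningRegion_removeAttr_subset {G : ParityGame α} {p : Fin 2} {X : Set α}
    (hA : G.attr p X ⊆ G.winningRegion p) (q : Fin 2) :
    (G.removeAttr p X).winningRegion q ⊆ G.winningRegion q := by
  intro v hv
  obtain ⟨τ', hτ', hvτ⟩ := mem_winningRegion_iff.1 hv
  rcases eq_or_eq_one_sub p q with rfl | rfl
  · refine mem_winningRegion_of_forall_not_mem (mem_nodes_removeAttr.1 hv.1).1 fun σ hσ hvσ => ?_
    -- A node won by `σ` is not won by the other player, so it escapes the deletion, as do its
    -- consistent successors.
    have hdisj : ∀ u ∈ G.winSet (1 - q) σ, u ∉ G.attr q X := fun u hu huA => by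
      obtain ⟨τ, hτ, huτ⟩ := mem_winningRegion_iff.1 (hA huA)
      exact not_mem_winSet_one_sub hτ hσ huτ hu
    obtain ⟨σ', hσ', heq⟩ := (G.removeAttr q X).exists_isStrategy_eqOn (1 - q)
      (G.winSet (1 - q) σ) σ fun u hu huσ => by
        have hV := (mem_V_removeAttr.1 hu).1
        exact ⟨hσ u hV, hdisj u huσ,
          hdisj _ (mem_winSet_of_step huσ ⟨hσ u hV, fun _ => rfl⟩)⟩
    refine not_mem_winSet_one_sub hτ' hσ' hvτ (winSet_subset_winSet (G := G)
      (H := G.removeAttr q X) rfl (fun u hu => mem_nodes_removeAttr.2 ⟨hu.1, hdisj u hu⟩) (fun u hu w hw => ?_) hvσ)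
    exact ⟨hw.1.1, fun h =>
      (hw.2 (mem_V_removeAttr.2 ⟨h, hdisj u hu⟩)).trans (heq u hu)⟩
  · obtain ⟨τ, hτ, hsub⟩ := G.exists_winSet_removeAttr_subset p X hτ'
    exact mem_winningRegion_iff.2 ⟨τ, hτ, hsub hvτ⟩

/-- Removing the edges from `k` into its monotone attractor does not enlarge the winning regions. -/
theorem winningRegion_removeEdges_subset {G : ParityGame α} {k : α}
    (hk : k ∉ G.ma {k} (G.color k)) (q : Fin 2) :
    (G.removeEdges k hk).winningRegion q ⊆ G.winningRegion q := by
  intro v hv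
  obtain ⟨τ', hτ', hvτ⟩ := mem_winningRegion_iff.1 hv
  -- When `k` belongs to the player of its color, non-fatality means that no edge is deleted at all.
  have hkp : ∀ w, k ∈ G.V (parity (G.color k)) → G.E k w → w ∉ G.ma {k} (G.color k) := by
    intro w hV hE hw
    apply hk
    rw [ma, ← mattr_eq]
    exact Or.inl ⟨hV, le_rfl, w, hE, Or.inl hw⟩
  rcases eq_or_eq_one_sub (parity (G.color k)) q with rfl | rfl
  · refine mem_winningRegion_of_forall_not_mem hv.1 fun σ hσ hvσ => ?_
    have hgood : ∀ u ∈ G.winSet (1 - parity (G.color k)) σ, u ∈ G.V (1 - parity (G.color k)) →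
        (G.removeEdges k hk).E u (σ u) := by
      rintro u hu hV
      refine ⟨hσ u hV, ?_⟩
      rintro ⟨rfl, hw⟩
      obtain ⟨y, hy, hp⟩ := exists_transGen_of_mem_ma hσ hw
      -- A deleted edge chosen by `σ`, followed by a path back to its source, is a cycle whose least
      -- color is that of the source.
      have hret : ∃ y ∈ ({u} : Set α), Relation.TransGen (fun v w =>
          G.Step (1 - parity (G.color u)) σ v w ∧ G.color u ≤ G.color v) u y :=
        ⟨y, hy, .head ⟨⟨hσ u hV, fun _ => rfl⟩, le_rfl⟩ hp⟩
      exact not_mem_winSet_of_transGen (X := {u}) (by rintro x rfl; rfl)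
        (by rintro x rfl; exact hret) hret hu
    obtain ⟨σ', hσ', heq⟩ := (G.removeEdges k hk).exists_isStrategy_eqOn
      (1 - parity (G.color k)) (G.winSet (1 - parity (G.color k)) σ) σ fun u hu huσ =>
        hgood u huσ hu
    refine not_mem_winSet_one_sub hτ' hσ' hvτ (winSet_subset_winSet (G := G)
      (H := G.removeEdges k hk) rfl
      (fun u hu => hu.1) (fun u hu w hw => ?_) hvσ)
    exact ⟨hw.1.1, fun h => (hw.2 h).trans (heq u hu)⟩
  · refine mem_winningRegion_iff.2 ⟨τ', fun u hu => (hτ' u hu).1,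
      winSet_subset_winSet (G := G.removeEdges k hk) (H := G) rfl (fun u hu => hu.1)
        (fun u hu w hw => ⟨⟨hw.1, ?_⟩, hw.2⟩) hvτ⟩
    rintro ⟨rfl, hwk⟩
    rcases G.mem_V_or (parity (G.color u)) hu.1 with h | h
    · exact hkp w h hw.1 hwk
    · have hE := hτ' u h
      rw [← hw.2 h] at hE
      exact hE.2 ⟨rfl, hwk⟩

/-! ### Soundness of the solvers -/

theorem record_win_subset {R : SolverResult α} {p q : Fin 2} {A W : Set α}
    (hA : q = p → A ⊆ W) (hR : R.win q ⊆ W) : (R.record p A).win q ⊆ W := by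
  simp only [SolverResult.record]
  split_ifs with h
  · exact Set.union_subset (hA h) hR
  · exact hR

/-- Each step is sound for any list `ks`, so the order of the nodes and the breaking of ties play no
role. -/
theorem psolLoop_win_subset (o : NodeOrder α) (G : ParityGame α) (ks : List α) (q : Fin 2) :
    (psolLoop o G ks).win q ⊆ G.winningRegion q := by
  induction G, ks using psolLoop.induct o with
  | case1 G => rw [psolLoop]; exact Set.empty_subset _
  | case2 G k ks h ih =>
    rw [psolLoop, dif_pos h]
    have hA := attr_ma_subset_winningRegion (G := G) (X := {k}) (d := G.color k)
      (by rintro x rfl; rfl) (Set.singleton_subset_iff.2 h)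
    exact record_win_subset (fun hq => hq ▸ hA)
      (ih.trans (winningRegion_removeAttr_subset hA q))
  | case3 G k ks h ih =>
    rw [psolLoop, dif_neg h]
    exact ih.trans (winningRegion_removeEdges_subset h q)

/-- This ensures that a fatal set found for color `d` consists of nodes of color `d`. -/
theorem psolBWhile_subset (G : ParityGame α) (d : ℕ) (X cache : Finset α)
    (Y : {Y : Finset α // Y.Nonempty ∧ (Y : Set α) ⊆ G.ma Y d})
    (h : psolBWhile G d X cache = some Y) : Y.1 ⊆ X := by
  induction X, cache using psolBWhile.induct G d with
  | case1 X cache h1 h2 =>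
    rw [psolBWhile, dif_pos h1, dif_pos h2] at h
    cases h
    exact Finset.Subset.refl _
  | case2 X cache h1 h2 ih =>
    rw [psolBWhile, dif_pos h1, dif_neg h2] at h
    exact (ih h).trans (by classical exact Finset.filter_subset _ _)
  | case3 X cache h1 =>
    rw [psolBWhile, dif_neg h1] at h
    cases h

theorem psolBLoop_win_subset (G : ParityGame α) (ds : List ℕ) (q : Fin 2) :
    (psolBLoop G ds).win q ⊆ G.winningRegion q := by
  induction G, ds using psolBLoop.induct with
  | case1 G => rw [psolBLoop]; exact Set.empty_subset _
  | case2 G d ds X hX heq ih =>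
    rw [psolBLoop, heq]
    have hsub := psolBWhile_subset _ _ _ _ _ heq
    have hA := attr_ma_subset_winningRegion (G := G) (X := X) (d := d)
      (fun x hx => (Finset.mem_filter.1 (hsub hx)).2) hX.2
    exact record_win_subset (fun hq => hq ▸ hA)
      (ih.trans (winningRegion_removeAttr_subset hA q))
  | case3 G d ds heq ih =>
    rw [psolBLoop, heq]
    exact ih

end ParityGame

theorem mainTheorem2 {α : Type*} (G : ParityGame α) :
    (∀ (o : ParityGame.NodeOrder α) (p : Fin 2),
      (ParityGame.psol o G).win p ⊆ G.winningRegion p) ∧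
    (∀ p : Fin 2, (ParityGame.psolB G).win p ⊆ G.winningRegion p) :=
  ⟨fun o p => ParityGame.psolLoop_win_subset o G _ p,
    fun p => ParityGame.psolBLoop_win_subset G _ p⟩
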